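/- Let $0\le\delta\le c$ be constants. For a bounded kernel (symmetric measurable function) $\kappa$ on $[0,1]^2$, let $G(n,\kappa)$ be the random graph on $\{1,\dots,n\}$ obtained by drawing $x_1,\dots,x_n$ independently and uniformly from $[0,1]$ and then, independently for each pair $\{i,j\}$, placing the edge $ij$ with probability $\kappa(x_i,x_j)/n$ (projected into $[0,1]$). Let $\mathbf Q_n=G(n,\kappa_1)$ with $\kappa_1\equiv c$, and let $\mathbf P_n=G(n,\kappa_2)$, where $\kappa_2$ equals $c+\delta$ at pairs of points in different halves of $[0,1]$ and $c-\delta$ at pairs of points in the same half (or the other way around: $c-\delta$ at pairs in different halves and $c+\delta$ at pairs in the same half). For graphs $G,H$ on the same vertex set let $d_1(G,H)=\min_{G'\cong G}|E(G')\,\triangle\,E(H)|$, the minimum being over graphs $G'$ on that vertex set. Then, uniformly over all couplings $\mu$ of $\mathbf P_n$ and $\mathbf Q_n$, $$\mathbf E_{(G,H)\sim\mu}\,[d_1(G,H)]=\Omega\!\left(\frac{\delta^{(\log n)^{1/3}}}{(\log n)^{1/3}}\right)\qquad(n\to\infty).$$ If moreover $\delta>1$, or $0<\delta\le c\le 1$,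 then also, uniformly over all couplings, $$\mathbf E_{(G,H)\sim\mu}\,[d_1(G,H)]=\Omega\!\left(\frac{c^{(\log n)^{1/3}}}{(\log n)^{1/3}}\right)\qquad(n\to\infty).$$ The implied constants and thresholds depend only on $c$ and $\delta$. -/

import Mathlib

open MeasureTheory Filter

noncomputable section

/-- Edit distance: the minimum of `|E(G') △ E(H)|` over the graphs `G'` on the same vertex set that
are isomorphic to `G`. -/
def editDist {V : Type*} (G H : SimpleGraph V) : ℕ :=
  sInf {m : ℕ | ∃ G' : SimpleGraph V,
    Nonempty (G' ≃g G) ∧ m = (symmDiff G'.edgeSet H.edgeSet).ncard}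

/-- A kernel: a symmetric measurable real function on `[0,1]²`. -/
structure GraphKernel where
  toFun : unitInterval → unitInterval → ℝ
  symm : ∀ x y, toFun x y = toFun y x
  measurable : Measurable (Function.uncurry toFun)

/-- The graph built from vertex variables `x = ω.1` and edge variables `u = ω.2`: the pair `{i, j}`
is an edge iff `u {i, j} < κ (x i) (x j) / n`. If `u {i, j}` is uniform on `[0,1]`, this happens
with probability `κ (x i) (x j) / n` projected into `[0,1]`. -/
def sampleGraph (n : ℕ) (κ : GraphKernel)
    (ω : (Fin n → unitInterval) × (Sym2 (Fin n) → unitInterval)) : SimpleGraph (Fin n) where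
  Adj i j := i ≠ j ∧ (ω.2 s(i, j) : ℝ) < κ.toFun (ω.1 i) (ω.1 j) / n
  symm := ⟨fun i j h => ⟨h.1.symm, by rw [Sym2.eq_swap, κ.symm]; exact h.2⟩⟩
  loopless := ⟨fun _ h => h.1 rfl⟩

/-- The law of the sparse random graph `G(n, κ)`: all vertex and edge variables are independent and
uniform on `[0,1]`. -/
def sparseGraphLaw (n : ℕ) (κ : GraphKernel) : Measure (SimpleGraph (Fin n)) :=
  Measure.map (sampleGraph n κ)
    ((volume : Measure (Fin n → unitInterval)).prod
      (volume : Measure (Sym2 (Fin n) → unitInterval)))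

/-- The kernel that is identically `c`. -/
def constKernel (c : ℝ) : GraphKernel where
  toFun _ _ := c
  symm _ _ := rfl
  measurable := measurable_const

open Classical in
/-- The two-block kernel: value `a` if both points lie in the same half of `[0,1]`, and `b` if they
lie in different halves. (Which half the midpoint `1/2` belongs to concerns a null set only.) -/
def blockKernel (a b : ℝ) : GraphKernel where
  toFun x y := if ((x : ℝ) < 1 / 2 ↔ (y : ℝ) < 1 / 2) then a else b
  symm x y := by simp only [iff_comm]
  measurable := by
    have h1 : MeasurableSet {p : unitInterval × unitInterval | (p.1 : ℝ) < 1 / 2} :=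
      measurableSet_lt (by fun_prop) (by fun_prop)
    have h2 : MeasurableSet {p : unitInterval × unitInterval | (p.2 : ℝ) < 1 / 2} :=
      measurableSet_lt (by fun_prop) (by fun_prop)
    exact Measurable.ite (h1.iff h2) measurable_const measurable_const

/-- `μ` is a coupling of `P` and `Q`: its marginals are `P` and `Q`. -/
def IsCoupling {α β : Type*} [MeasurableSpace α] [MeasurableSpace β]
    (μ : Measure (α × β)) (P : Measure α) (Q : Measure β) : Prop :=
  μ.map Prod.fst = P ∧ μ.map Prod.snd = Q

/-- Every coupling of `G(n, κ₁)` and `G(n, κ₂)` has expected edit distance `Ω(r n)`, the implied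
constant and threshold being the same for all couplings. -/
def EveryCouplingOmega (κ₁ κ₂ : GraphKernel) (r : ℕ → ℝ) : Prop :=
  ∃ C : ℝ, 0 < C ∧ ∀ᶠ n : ℕ in atTop,
    ∀ μ : Measure (SimpleGraph (Fin n) × SimpleGraph (Fin n)),
      IsCoupling μ (sparseGraphLaw n κ₁) (sparseGraphLaw n κ₂) →
        C * r n ≤ ∫ p, (editDist p.1 p.2 : ℝ) ∂μ

/-- The rate `b ^ ((log n) ^ (1/3)) / (log n) ^ (1/3)`. -/
def cycleRate (b : ℝ) (n : ℕ) : ℝ :=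
  b ^ (Real.log n ^ (1 / 3 : ℝ)) / Real.log n ^ (1 / 3 : ℝ)

end

/-! The invariant that separates the two models is the number of `k`-cycles. With `a = ±δ`, the
block kernel is `c + a s(x) s(y)` for a sign `s` of mean zero, so its eigenvalues are `c` and `a`.
Its expected rooted, oriented `k`-cycle count is about `c ^ k + a ^ k`, against `c ^ k` for the
constant kernel (`integral_prod_blockKernel`).

Editing one edge could destroy many cycles, but only if they share that edge. Two such cycles
contain a cycle with an ear (`exists_isEar`), a configuration with more edges than vertices, whose
expected number is `O(1/n)` up to factors exponential in `k` (`integral_earCount_le`). Apart from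
these, an edit costs at most `2 * k` rooted oriented cycles (`cycleCount_le_add`). Taking
expectations under any coupling bounds the expected edit distance below by `a ^ k / (8 * k)`
(`le_integral_editDist`).

It remains to choose an even `k`, so that the sign of `a` is harmless. For a base at most `1` the
rate is bounded and `k = 4` suffices; for `|a| > 1` a multiple of `(log n) ^ (1/3)` is taken, large
enough that `|a| ^ k` exceeds `c ^ ((log n) ^ (1/3))`. -/

/-! ### Cycles, ears and the effect of edits -/

section Cycles

variable {V : Type*} {k : ℕ}

/-- The edges of the closed walk `f`. -/
def cycleEdge (f : ZMod k → V) (i : ZMod k) : Sym2 V := s(f i, f (i + 1))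

/-- The edges of the walk `e`. -/
def pathEdge {m : ℕ} (e : Fin (m + 2) → V) (j : Fin (m + 1)) : Sym2 V :=
  s(e j.castSucc, e j.succ)

/-- `f` traverses a cycle of length `k` in `G`. -/
def IsCycleMap (G : SimpleGraph V) (f : ZMod k → V) : Prop :=
  Function.Injective f ∧ Set.range (cycleEdge f) ⊆ G.edgeSet

theorem two_ne_zero_zmod (hk : 3 ≤ k) : (2 : ZMod k) ≠ 0 := by
  intro h
  have h2 : ((2 : ℕ) : ZMod k) = 0 := by exact_mod_cast h
  rw [ZMod.natCast_eq_zero_iff] at h2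
  exact absurd (Nat.le_of_dvd (by norm_num) h2) (by omega)

theorem cycleEdge_injective (hk : 3 ≤ k) {f : ZMod k → V} (hf : Function.Injective f) :
    Function.Injective (cycleEdge f) := by
  intro i j h
  simp only [cycleEdge, Sym2.eq_iff] at h
  rcases h with ⟨h, -⟩ | ⟨h1, h2⟩
  · exact hf h
  · have h1 := hf h1
    have h2 := hf h2
    exact absurd (by linear_combination h2 - h1) (two_ne_zero_zmod hk)

/-- `e` is a path whose ends lie on the cycle `f` and which has no edge in common with it. -/
structure IsEar {m : ℕ} (f : ZMod k → V) (e : Fin (m + 2) → V) : Prop where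
  left : e 0 ∈ Set.range f
  right : e (Fin.last _) ∈ Set.range f
  edges : Function.Injective (Sum.elim (cycleEdge f) (pathEdge e))

/-- Two different cycles with a common edge give rise to a cycle with an ear. -/
theorem exists_isEar [NeZero k] (hk : 3 ≤ k) {G : SimpleGraph V} {f g : ZMod k → V}
    (hf : IsCycleMap G f) (hg : IsCycleMap G g) {i : ZMod k} (h0 : f i = g i)
    (h1 : f (i + 1) = g (i + 1)) (hne : f ≠ g) :
    ∃ m < k, ∃ e : Fin (m + 2) → V, IsEar f e ∧ Set.range (pathEdge e) ⊆ G.edgeSet := by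
  classical
  have cast_inj : ∀ a b : ℕ, a < k → b < k → (a : ZMod k) = b → a = b := by
    intro a b ha hb h
    rwa [ZMod.natCast_eq_natCast_iff', Nat.mod_eq_of_lt ha, Nat.mod_eq_of_lt hb] at h
  have hex : ∃ t : ℕ, f (i + t) ≠ g (i + t) := by
    obtain ⟨j, hj⟩ := Function.ne_iff.1 hne
    refine ⟨(j - i).val, ?_⟩
    rw [ZMod.natCast_zmod_val]
    simpa using hj
  -- `t` is the first step at which `g` leaves `f`; the ear starts one step earlier, at `s = t - 1`.
  -- The common edge forces `t ≥ 2`, hence `s ≥ 1`.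
  set t := Nat.find hex with ht
  have htne : f (i + t) ≠ g (i + t) := Nat.find_spec hex
  have htlt : ∀ u < t, f (i + u) = g (i + u) := fun u hu => by
    simpa using Nat.find_min hex hu
  have ht2 : 2 ≤ t := by
    by_contra hlt
    have : t = 0 ∨ t = 1 := by omega
    rcases this with h | h <;> rw [h] at htne <;> simp [h0, h1] at htne
  have htk : t < k := by
    obtain ⟨j, hj⟩ := Function.ne_iff.1 hne
    refine lt_of_le_of_lt (Nat.find_min' hex (m := (j - i).val) ?_) (ZMod.val_lt _)
    rw [ZMod.natCast_zmod_val]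
    simpa using hj
  obtain ⟨s, hs⟩ : ∃ s, t = s + 1 := ⟨t - 1, by omega⟩
  -- The ear ends at the first return of `g` to the vertices of `f`, at the latest when `g` closes
  -- up at `g i = f i`.
  have hret : ∃ m : ℕ, g (i + ((s + 1 + m : ℕ) : ZMod k)) ∈ Set.range f := by
    refine ⟨k - (s + 1), i, ?_⟩
    rw [show s + 1 + (k - (s + 1)) = k by omega]
    simpa using h0
  set m := Nat.find hret with hm
  have hmmem : g (i + ((s + 1 + m : ℕ) : ZMod k)) ∈ Set.range f := Nat.find_spec hret
  have hmlt : ∀ u < m, g (i + ((s + 1 + u : ℕ) : ZMod k)) ∉ Set.range f := fun u hu =>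
    Nat.find_min hret hu
  have hmk : m ≤ k - (s + 1) := by
    refine Nat.find_min' hret ⟨i, ?_⟩
    rw [show s + 1 + (k - (s + 1)) = k by omega]
    simpa using h0
  have hpe : ∀ j : Fin (m + 1), pathEdge (fun j : Fin (m + 2) => g (i + ((s + j : ℕ) : ZMod k))) j
      = cycleEdge g (i + ((s + j : ℕ) : ZMod k)) := by
    intro j
    have : i + ((s + (j + 1) : ℕ) : ZMod k) = i + ((s + j : ℕ) : ZMod k) + 1 := by
      push_cast; ring
    simp only [pathEdge, cycleEdge, Fin.val_castSucc, Fin.val_succ, this]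
  have hfs : f (i + s) = g (i + s) := htlt s (by omega)
  refine ⟨m, by omega, fun j => g (i + ((s + j : ℕ) : ZMod k)), ⟨⟨i + s, ?_⟩, ?_, ?_⟩, ?_⟩
  · simpa using hfs
  · convert hmmem using 4
    simp [Fin.last]
    omega
  · refine Function.Injective.sumElim (cycleEdge_injective hk hf.1) ?_ ?_
    · intro j j' h
      rw [hpe, hpe] at h
      have h := add_left_cancel (cycleEdge_injective hk hg.1 h)
      push_cast at h
      exact Fin.ext (cast_inj _ _ (by omega) (by omega) (add_left_cancel h))
    -- An ear edge lying on `f` has both ends on `f`, so by minimality of `m` it is the first one,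
    -- at `f (i + s)`. As a forward edge of `f` it contradicts the choice of `t`; as a backward edge
    -- it makes `g` return to its previous vertex.
    · intro u j h
      have hl : f u ∈ Set.range f := ⟨u, rfl⟩
      have hr : f (u + 1) ∈ Set.range f := ⟨u + 1, rfl⟩
      have hends : g (i + ((s + j : ℕ) : ZMod k)) ∈ Set.range f ∧
          g (i + ((s + 1 + j : ℕ) : ZMod k)) ∈ Set.range f := by
        rw [hpe, cycleEdge, cycleEdge, Sym2.eq_iff] at h
        have : i + ((s + 1 + j : ℕ) : ZMod k) = i + ((s + j : ℕ) : ZMod k) + 1 := by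
          push_cast; ring
        rw [this]
        rcases h with ⟨h, h'⟩ | ⟨h, h'⟩
        · rw [← h, ← h']; exact ⟨hl, hr⟩
        · rw [← h, ← h']; exact ⟨hr, hl⟩
      have hj0 : (j : ℕ) = 0 := by
        by_contra hj
        refine hmlt (j - 1) (by omega) ?_
        rw [show s + 1 + ((j : ℕ) - 1) = s + j by omega]
        exact hends.1
      rw [hpe, cycleEdge, cycleEdge, Sym2.eq_iff, hj0, add_zero, ← hfs] at h
      rcases h with ⟨h, h'⟩ | ⟨h, h'⟩
      · rw [hf.1 h] at h'
        apply htne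
        rw [hs]
        push_cast
        rw [← add_assoc]
        exact h'
      · have hu := hf.1 h'
        obtain ⟨r, hr⟩ : ∃ r, s = r + 1 := ⟨s - 1, by omega⟩
        have hgr := htlt r (by omega)
        have : u = i + r := by
          rw [hr] at hu
          push_cast at hu
          linear_combination hu
        rw [this, hgr] at h
        have := hg.1 h
        rw [hr] at this
        push_cast at this
        exact two_ne_zero_zmod hk (by linear_combination -this)
  · rintro _ ⟨j, rfl⟩
    rw [hpe]
    exact hg.2 ⟨_, rfl⟩

variable [Fintype V]

open Classical in
/-- The number of cycles of length `k` in `G`, each counted once for every starting point and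
direction. -/
noncomputable def cycleCount (k : ℕ) [NeZero k] (G : SimpleGraph V) : ℕ :=
  (Finset.univ.filter fun f : ZMod k → V => IsCycleMap G f).card

open Classical in
/-- The number of cycles of length `k` in `G` with an ear of length `m + 1`. -/
noncomputable def earCount (k m : ℕ) [NeZero k] (G : SimpleGraph V) : ℕ :=
  (Finset.univ.filter fun p : (ZMod k → V) × (Fin (m + 2) → V) =>
    IsEar p.1 p.2 ∧ Set.range (Sum.elim (cycleEdge p.1) (pathEdge p.2)) ⊆ G.edgeSet).card

open Classical in
theorem card_orientations_le (D : Finset (Sym2 V)) :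
    (Finset.univ.filter fun p : V × V => s(p.1, p.2) ∈ D).card ≤ 2 * D.card := by
  refine (Finset.card_le_mul_card_image_of_maps_to (f := fun p : V × V => s(p.1, p.2))
    (t := D) (fun p hp => by simpa using hp) 2 ?_)
  intro z _
  induction z using Sym2.ind with
  | _ x y =>
    refine (Finset.card_le_card (t := {(x, y), (y, x)}) ?_).trans Finset.card_le_two
    rintro ⟨a, b⟩ h
    simp only [Finset.mem_filter, Sym2.eq_iff] at h
    simpa [Prod.ext_iff] using h.2

/-- A cycle of `G` lost in `H` uses an edited edge. Either some other cycle of `G` shares an edge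
with it, and it carries an ear, or it is determined by any one of its oriented edges together with
the position of that edge. -/
theorem cycleCount_le_add [NeZero k] (hk : 3 ≤ k) (G H : SimpleGraph V) :
    cycleCount k G ≤ cycleCount k H + 2 * k * (symmDiff G.edgeSet H.edgeSet).ncard
      + ∑ m ∈ Finset.range k, earCount k m G := by
  classical
  let D : Finset (Sym2 V) := (symmDiff G.edgeSet H.edgeSet).toFinset
  -- Uniqueness is required only against cycles with the same oriented edge at the same position;
  -- this is exactly what the injection into positions and oriented edges needs.
  let good : Finset (ZMod k → V) := Finset.univ.filter fun f => IsCycleMap G f ∧ ¬ IsCycleMap H f ∧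
    ∀ g, IsCycleMap G g → ∀ i, f i = g i → f (i + 1) = g (i + 1) → f = g
  let ears (m : ℕ) : Finset ((ZMod k → V) × (Fin (m + 2) → V)) := Finset.univ.filter fun p =>
    IsEar p.1 p.2 ∧ Set.range (Sum.elim (cycleEdge p.1) (pathEdge p.2)) ⊆ G.edgeSet
  have hgood : good.card ≤ 2 * k * D.card := by
    have hex : ∀ f ∈ good, ∃ i, cycleEdge f i ∈ D := by
      intro f hf
      simp only [good, Finset.mem_filter, Finset.mem_univ, true_and] at hf
      have : ¬ Set.range (cycleEdge f) ⊆ H.edgeSet := fun h => hf.2.1 ⟨hf.1.1, h⟩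
      rw [Set.range_subset_iff] at this
      push Not at this
      obtain ⟨i, hi⟩ := this
      refine ⟨i, ?_⟩
      simp only [D, Set.mem_toFinset, Set.mem_symmDiff]
      exact Or.inl ⟨hf.1.2 ⟨i, rfl⟩, hi⟩
    choose! i hi using hex
    calc good.card ≤ ((Finset.univ : Finset (ZMod k)) ×ˢ
          (Finset.univ.filter fun p : V × V => s(p.1, p.2) ∈ D)).card := by
          refine Finset.card_le_card_of_injOn (fun f => (i f, (f (i f), f (i f + 1)))) ?_ ?_
          · intro f hf
            simpa [cycleEdge] using hi f hf
          · intro f hf g hg h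
            simp only [Prod.mk.injEq] at h
            obtain ⟨h1, h2, h3⟩ := h
            have hf' := (Finset.mem_filter.1 hf).2
            have hg' := (Finset.mem_filter.1 hg).2
            exact hf'.2.2 g hg'.1 (i f) (by rw [h2, h1]) (by rw [h3, h1])
      _ = k * (Finset.univ.filter fun p : V × V => s(p.1, p.2) ∈ D).card := by
          rw [Finset.card_product, Finset.card_univ, ZMod.card]
      _ ≤ k * (2 * D.card) := Nat.mul_le_mul_left _ (card_orientations_le D)
      _ = _ := by ring
  have hD : D.card = (symmDiff G.edgeSet H.edgeSet).ncard := (Set.ncard_eq_toFinset_card' _).symm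
  have hsub : (Finset.univ.filter fun f : ZMod k → V => IsCycleMap G f) ⊆
      ((Finset.univ.filter fun f : ZMod k → V => IsCycleMap H f) ∪ good) ∪
        (Finset.range k).biUnion fun m => (ears m).image Prod.fst := by
    intro f hf
    simp only [Finset.mem_filter, Finset.mem_univ, true_and] at hf
    by_cases hH : IsCycleMap H f
    · simp [hH]
    by_cases hg : f ∈ good
    · simp [hg]
    simp only [good, Finset.mem_filter, Finset.mem_univ, true_and, hf, hH, not_false_eq_true] at hg
    push Not at hg
    obtain ⟨g, hg, i, h0, h1, hne⟩ := hg
    obtain ⟨m, hm, e, he, hG⟩ := exists_isEar hk hf hg h0 h1 hne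
    refine Finset.mem_union_right _ (Finset.mem_biUnion.2 ⟨m, Finset.mem_range.2 hm,
      Finset.mem_image.2 ⟨(f, e), ?_, rfl⟩⟩)
    simp only [ears, Finset.mem_filter, Finset.mem_univ, true_and]
    exact ⟨he, by rw [Set.Sum.elim_range]; exact Set.union_subset hf.2 hG⟩
  calc cycleCount k G ≤ _ := Finset.card_le_card hsub
    _ ≤ _ := Finset.card_union_le _ _
    _ ≤ _ := by
      gcongr
      · refine (Finset.card_union_le _ _).trans ?_
        rw [← hD]
        exact Nat.add_le_add_left hgood _
      · refine Finset.card_biUnion_le.trans (Finset.sum_le_sum fun m _ => ?_)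
        exact Finset.card_image_le

theorem cycleCount_le_of_iso [NeZero k] {G H : SimpleGraph V} (φ : G ≃g H) :
    cycleCount k G ≤ cycleCount k H := by
  classical
  refine Finset.card_le_card_of_injOn (fun f => φ ∘ f) ?_ ?_
  · intro f hf
    simp only [Finset.coe_filter, Finset.mem_univ, true_and, Set.mem_ofPred_eq] at hf ⊢
    refine ⟨φ.injective.comp hf.1, ?_⟩
    rw [Set.range_subset_iff]
    intro i
    have := hf.2 ⟨i, rfl⟩
    simp only [cycleEdge, SimpleGraph.mem_edgeSet, Function.comp] at this ⊢
    exact φ.map_adj_iff.2 this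
  · intro f _ g _ h
    exact φ.injective.comp_left h

/-- The optimal relabelling is moved from `G` to `H`, whose cycle count it preserves, so that the
ears are still counted in `G` itself. -/
theorem cycleCount_le_add_editDist [NeZero k] (hk : 3 ≤ k) (G H : SimpleGraph V) :
    cycleCount k G ≤ cycleCount k H + 2 * k * editDist G H
      + ∑ m ∈ Finset.range k, earCount k m G := by
  obtain ⟨G', ⟨φ⟩, hd⟩ := Nat.sInf_mem (s := {m : ℕ | ∃ G' : SimpleGraph V,
    Nonempty (G' ≃g G) ∧ m = (symmDiff G'.edgeSet H.edgeSet).ncard}) ⟨_, G, ⟨.refl⟩, rfl⟩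
  let H' : SimpleGraph V := H.comap φ.symm
  have hiso : H' ≃g H := SimpleGraph.Iso.comap φ.symm.toEquiv H
  have hinj : Function.Injective (Sym2.map φ.symm) := Sym2.map.injective φ.symm.injective
  have hsymm : (symmDiff G.edgeSet H'.edgeSet).ncard ≤ editDist G H := by
    rw [editDist, hd]
    refine Set.ncard_le_ncard_of_injOn (Sym2.map φ.symm) ?_ hinj.injOn (Set.toFinite _)
    intro z hz
    induction z using Sym2.ind with
    | _ x y =>
      have hG : G'.Adj (φ.symm x) (φ.symm y) ↔ G.Adj x y := φ.symm.map_adj_iff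
      simpa [Set.mem_symmDiff, H', hG] using hz
  calc cycleCount k G ≤ _ := cycleCount_le_add hk G H'
    _ ≤ _ := by
      gcongr
      exact cycleCount_le_of_iso hiso

end Cycles

/-! ### Number of possible ears -/

section Counting

-- An ear is determined by its `m` inner vertices and the positions of its two ends on the cycle: `k
-- + m` free vertices for `k + m + 1` edges.
open Classical in
theorem card_isEar_le {V : Type*} [Fintype V] (k m : ℕ) [NeZero k] :
    (Finset.univ.filter fun p : (ZMod k → V) × (Fin (m + 2) → V) => IsEar p.1 p.2).card ≤
      Fintype.card V ^ (k + m) * k ^ 2 := by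
  have hsub : (Finset.univ.filter fun p : (ZMod k → V) × (Fin (m + 2) → V) => IsEar p.1 p.2) ⊆
      (Finset.univ : Finset ((ZMod k → V) × (Fin m → V) × ZMod k × ZMod k)).image fun q =>
        (q.1, Fin.cons (q.1 q.2.2.1) (Fin.snoc q.2.1 (q.1 q.2.2.2) : Fin (m + 1) → V)) := by
    rintro ⟨f, e⟩ h
    obtain ⟨⟨a, ha⟩, ⟨b, hb⟩, -⟩ := (Finset.mem_filter.1 h).2
    refine Finset.mem_image.2 ⟨(f, Fin.init (Fin.tail e), a, b), Finset.mem_univ _, ?_⟩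
    dsimp only at ha hb ⊢
    rw [ha, hb, show e (Fin.last _) = Fin.tail e (Fin.last _) by rfl, Fin.snoc_init_self,
      Fin.cons_self_tail]
  refine (Finset.card_le_card hsub).trans (Finset.card_image_le.trans (le_of_eq ?_))
  simp only [Finset.card_univ, Fintype.card_prod, Fintype.card_fun, ZMod.card, Fintype.card_fin]
  ring

end Counting

/-! ### Edge probabilities in the random graph -/

section Law

variable {n : ℕ}

instance : MeasurableSingletonClass (SimpleGraph (Fin n)) where
  measurableSet_singleton G := by
    have : ({G} : Set (SimpleGraph (Fin n))) = SimpleGraph.Adj ⁻¹' {G.Adj} := by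
      ext H
      exact ⟨congrArg _, fun h => SimpleGraph.ext h⟩
    rw [this]
    exact SimpleGraph.measurable_adj (measurableSet_singleton _)

theorem measurable_sampleGraph (κ : GraphKernel) : Measurable (sampleGraph n κ) := by
  rw [SimpleGraph.measurable_iff_adj]
  intro i j
  refine Measurable.and measurable_const (measurableSet_setOfPred.1 (measurableSet_lt ?_ ?_))
  · fun_prop
  · have : Measurable fun ω : (Fin n → unitInterval) × (Sym2 (Fin n) → unitInterval) =>
        Function.uncurry κ.toFun (ω.1 i, ω.1 j) := κ.measurable.comp (by fun_prop)
    exact this.div_const _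

instance (κ : GraphKernel) : IsProbabilityMeasure (sparseGraphLaw n κ) :=
  Measure.isProbabilityMeasure_map (measurable_sampleGraph κ).aemeasurable

theorem sparseGraphLaw_real_apply (κ : GraphKernel) (s : Set (SimpleGraph (Fin n))) :
    (sparseGraphLaw n κ).real s = ((volume : Measure (Fin n → unitInterval)).prod
      (volume : Measure (Sym2 (Fin n) → unitInterval))).real (sampleGraph n κ ⁻¹' s) :=
  map_measureReal_apply (measurable_sampleGraph κ) (Set.toFinite s).measurableSet

open Classical in
theorem integral_card_filter {α τ : Type*} [MeasurableSpace α] [MeasurableSingletonClass α]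
    [Finite α] (ν : Measure α) [IsFiniteMeasure ν] (T : Finset τ) (R : τ → α → Prop) :
    ∫ a, ((T.filter fun t => R t a).card : ℝ) ∂ν = ∑ t ∈ T, ν.real {a | R t a} := by
  simp only [Finset.card_filter, Nat.cast_sum]
  rw [integral_finsetSum _ fun _ _ => Integrable.of_finite]
  refine Finset.sum_congr rfl fun t _ => ?_
  rw [← integral_indicator_one (Set.toFinite _).measurableSet]
  refine integral_congr_ae (Eventually.of_forall fun a => ?_)
  simp [Set.indicator_apply]

/-- The probability that independent uniform variables lie below given thresholds. -/
theorem volume_pi_lt {E ι : Type*} [Fintype E] [Fintype ι] {ℓ : ι → E}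
    (hℓ : Function.Injective ℓ) (t : ι → ℝ) :
    (volume : Measure (E → unitInterval)) {u | ∀ i, (u (ℓ i) : ℝ) < t i} =
      ∏ i, volume {y : unitInterval | (y : ℝ) < t i} := by
  have : {u : E → unitInterval | ∀ i, (u (ℓ i) : ℝ) < t i} =
      Set.univ.pi fun e => {y : unitInterval | ∀ i, ℓ i = e → (y : ℝ) < t i} := by
    ext u
    simp only [Set.mem_ofPred_eq, Set.mem_univ_pi]
    exact ⟨fun h e i hi => hi ▸ h i, fun h i => h _ i rfl⟩
  rw [this, volume_pi, Measure.pi_pi]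
  refine (Fintype.prod_of_injective ℓ hℓ _ _ ?_ ?_).symm
  · intro e he
    have : {y : unitInterval | ∀ i, ℓ i = e → (y : ℝ) < t i} = Set.univ :=
      Set.eq_univ_of_forall fun y i hi => absurd ⟨i, hi⟩ he
    rw [this, measure_univ]
  · intro i
    simp only [hℓ.eq_iff, forall_eq]

theorem volume_unitInterval_lt {t : ℝ} (ht : t ≤ 1) :
    volume {y : unitInterval | (y : ℝ) < t} = ENNReal.ofReal t := by
  rcases lt_or_ge t 0 with h | h
  · have : {y : unitInterval | (y : ℝ) < t} = ∅ :=
      Set.eq_empty_of_forall_notMem fun y hy => absurd (h.trans_le y.2.1) (not_lt.2 (le_of_lt hy))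
    rw [this, measure_empty, ENNReal.ofReal_of_nonpos h.le]
  · exact unitInterval.volume_Iio (x := ⟨t, h, ht⟩)

/-- Given distinct pairs are all edges with probability at most `q / n` to their number. -/
theorem prob_edges_le {κ : GraphKernel} {q : ℝ} (hq : ∀ x y, κ.toFun x y ≤ q) (hqn : q ≤ n)
    (hq0 : 0 ≤ q) {ι : Type*} [Fintype ι] {ℓ : ι → Sym2 (Fin n)} (hℓ : Function.Injective ℓ) :
    (sparseGraphLaw n κ).real {G | Set.range ℓ ⊆ G.edgeSet} ≤ (q / n) ^ Fintype.card ι := by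
  rw [sparseGraphLaw_real_apply]
  have hsub : sampleGraph n κ ⁻¹' {G | Set.range ℓ ⊆ G.edgeSet} ⊆
      Set.univ ×ˢ {u | ∀ i, (u (ℓ i) : ℝ) < q / n} := by
    rintro ⟨x, u⟩ h
    simp only [Set.mem_prod, Set.mem_univ, true_and, Set.mem_ofPred_eq]
    intro i
    have h := h ⟨i, rfl⟩
    revert h
    generalize ℓ i = z
    induction z using Sym2.ind with
    | _ a b =>
      rintro ⟨-, h⟩
      exact h.trans_le (div_le_div_of_nonneg_right (hq _ _) (Nat.cast_nonneg n))
  refine (measureReal_mono hsub).trans (le_of_eq ?_)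
  rw [measureReal_prod_prod, probReal_univ, one_mul, measureReal_def, volume_pi_lt hℓ]
  simp only [volume_unitInterval_lt (div_le_one_of_le₀ hqn (Nat.cast_nonneg n))]
  rw [Finset.prod_const, ENNReal.toReal_pow, ENNReal.toReal_ofReal (by positivity),
    Finset.card_univ]

/-- Given the vertex variables, the `k` edges are independent because they are distinct pairs. -/
theorem prob_cycle_eq {κ : GraphKernel} {k : ℕ} [NeZero k] (hk : 3 ≤ k)
    (h0 : ∀ x y, 0 ≤ κ.toFun x y) (hn : ∀ x y, κ.toFun x y ≤ n)
    {f : ZMod k → Fin n} (hf : Function.Injective f) :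
    (sparseGraphLaw n κ).real {G | Set.range (cycleEdge f) ⊆ G.edgeSet} =
      (∫ x : Fin n → unitInterval, ∏ i, κ.toFun (x (f i)) (x (f (i + 1)))) / n ^ k := by
  have hmeas : Measurable fun x : Fin n → unitInterval =>
      ∏ i, κ.toFun (x (f i)) (x (f (i + 1))) := by
    refine Finset.measurable_prod _ fun i _ => ?_
    have : Measurable fun x : Fin n → unitInterval =>
        Function.uncurry κ.toFun (x (f i), x (f (i + 1))) := κ.measurable.comp (by fun_prop)
    exact this
  have : Fact (1 < k) := ⟨by omega⟩
  rw [sparseGraphLaw_real_apply, measureReal_def, Measure.prod_apply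
    (measurable_sampleGraph κ (Set.toFinite _).measurableSet), ← integral_div,
    integral_eq_lintegral_of_nonneg_ae]
  · congr 1
    refine lintegral_congr fun x => ?_
    have : Prod.mk x ⁻¹' (sampleGraph n κ ⁻¹' {G | Set.range (cycleEdge f) ⊆ G.edgeSet}) =
        {u | ∀ i, (u (cycleEdge f i) : ℝ) < κ.toFun (x (f i)) (x (f (i + 1))) / n} := by
      ext u
      simp only [Set.mem_preimage, Set.mem_ofPred_eq, Set.range_subset_iff]
      refine forall_congr' fun i => ?_
      have : f i ≠ f (i + 1) := fun h => by simpa using hf h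
      simp [cycleEdge, sampleGraph, this]
    rw [this, volume_pi_lt (cycleEdge_injective hk hf)]
    have hle : ∀ i, κ.toFun (x (f i)) (x (f (i + 1))) / n ≤ 1 := fun i =>
      div_le_one_of_le₀ (hn _ _) (Nat.cast_nonneg n)
    simp only [volume_unitInterval_lt (hle _)]
    rw [← ENNReal.ofReal_prod_of_nonneg fun i _ => div_nonneg (h0 _ _) (Nat.cast_nonneg n),
      Finset.prod_div_distrib, Finset.prod_const, Finset.card_univ, ZMod.card]
  · exact Eventually.of_forall fun x => div_nonneg (Finset.prod_nonneg fun i _ => h0 _ _)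
      (by positivity)
  · exact (hmeas.div_const _).aestronglyMeasurable

end Law

/-! ### Cycle density of the block kernel -/

section Block

/-- The sign of a point of `[0,1]`: `1` on the left half, `-1` on the right half. -/
noncomputable def halfSign (x : unitInterval) : ℝ := if (x : ℝ) < 1 / 2 then 1 else -1

theorem halfSign_mul_self (x : unitInterval) : halfSign x * halfSign x = 1 := by
  unfold halfSign; split_ifs <;> norm_num

theorem measurable_halfSign : Measurable halfSign :=
  Measurable.ite (measurableSet_lt (by fun_prop) (by fun_prop)) measurable_const measurable_const

theorem integral_halfSign : ∫ x, halfSign x = 0 := by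
  have h1 : ∀ x, halfSign x = 2 * Set.indicator {y : unitInterval | (y : ℝ) < 1 / 2} 1 x - 1 := by
    intro x
    simp only [halfSign, Set.indicator_apply, Set.mem_ofPred_eq, Pi.one_apply]
    split_ifs <;> norm_num
  have hm : MeasurableSet {y : unitInterval | (y : ℝ) < 1 / 2} :=
    measurableSet_lt (by fun_prop) (by fun_prop)
  simp only [h1]
  rw [integral_sub (((integrable_indicator_iff hm).2 (integrable_const _).integrableOn).const_mul _)
    (integrable_const _), integral_const_mul, integral_indicator_one hm, measureReal_def,
    volume_unitInterval_lt (by norm_num)]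
  simp

theorem blockKernel_apply (c a : ℝ) (x y : unitInterval) :
    (blockKernel (c + a) (c - a)).toFun x y = c + a * (halfSign x * halfSign y) := by
  by_cases hx : (x : ℝ) < 1 / 2 <;> by_cases hy : (y : ℝ) < 1 / 2 <;>
    simp only [blockKernel, halfSign, hx, hy, if_true, if_false, iff_self, iff_false, iff_true,
      not_true_eq_false] <;> ring

/-- A product of signs along edges of a cycle has mean zero unless all edges, or none, occur. -/
theorem integral_prod_halfSign {V : Type*} [Fintype V] {k : ℕ} [NeZero k] {f : ZMod k → V}
    (hf : Function.Injective f) {S : Finset (ZMod k)} (hS : S.Nonempty) (hS' : S ≠ Finset.univ) :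
    ∫ x : V → unitInterval, ∏ i ∈ S, (halfSign (x (f i)) * halfSign (x (f (i + 1)))) = 0 := by
  classical
  -- At a place where `S` stops, the sign of `f (i + 1)` occurs exactly once in the product, so
  -- after grouping by vertices its factor integrates to zero.
  obtain ⟨i, hi, hi'⟩ : ∃ i ∈ S, i + 1 ∉ S := by
    by_contra! h
    obtain ⟨j, hj⟩ := hS
    refine hS' (Finset.eq_univ_iff_forall.2 fun i => ?_)
    have : ∀ m : ℕ, j + m ∈ S := by
      intro m
      induction m with
      | zero => simpa using hj
      | succ m ih => simpa [add_assoc] using h _ ih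
    simpa using this (i - j).val
  have hprod : ∀ x : V → unitInterval,
      ∏ i ∈ S, (halfSign (x (f i)) * halfSign (x (f (i + 1)))) =
      ∏ v, halfSign (x v) ^ ((S.filter fun i => f i = v).card +
        (S.filter fun i => f (i + 1) = v).card) := by
    intro x
    simp only [pow_add]
    rw [Finset.prod_mul_distrib, Finset.prod_mul_distrib]
    congr 1
    · rw [← Finset.prod_fiberwise_of_maps_to (g := f) (t := Finset.univ) (by simp)]
      refine Finset.prod_congr rfl fun v _ => ?_
      rw [Finset.prod_congr rfl (g := fun _ => halfSign (x v)), Finset.prod_const]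
      intro i hi
      rw [(Finset.mem_filter.1 hi).2]
    · rw [← Finset.prod_fiberwise_of_maps_to (g := fun i => f (i + 1)) (t := Finset.univ) (by simp)]
      refine Finset.prod_congr rfl fun v _ => ?_
      rw [Finset.prod_congr rfl (g := fun _ => halfSign (x v)), Finset.prod_const]
      intro i hi
      rw [(Finset.mem_filter.1 hi).2]
  simp only [hprod]
  rw [volume_pi, integral_fintype_prod_eq_prod (f := fun v y => halfSign y ^
    ((S.filter fun i => f i = v).card + (S.filter fun i => f (i + 1) = v).card))]
  refine Finset.prod_eq_zero (Finset.mem_univ (f (i + 1))) ?_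
  have h1 : (S.filter fun j => f j = f (i + 1)) = ∅ := by
    ext j
    simp only [Finset.mem_filter, hf.eq_iff, Finset.notMem_empty, iff_false, not_and]
    rintro hj rfl
    exact hi' hj
  have h2 : (S.filter fun j => f (j + 1) = f (i + 1)) = {i} := by
    ext j
    simp only [Finset.mem_filter, hf.eq_iff, add_left_inj, Finset.mem_singleton]
    exact ⟨fun h => h.2, fun h => ⟨h ▸ hi, h⟩⟩
  simp only [h1, h2, Finset.card_empty, Finset.card_singleton, zero_add, pow_one]
  exact integral_halfSign

/-- Expanding the product over sets `S` of edges leaves two terms: the empty set gives `c ^ k`, and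
the full cycle gives `a ^ k` since each sign then occurs twice. -/
theorem integral_prod_blockKernel {V : Type*} [Fintype V] {k : ℕ} [NeZero k] {f : ZMod k → V}
    (hf : Function.Injective f) (c a : ℝ) :
    ∫ x : V → unitInterval, ∏ i, (blockKernel (c + a) (c - a)).toFun (x (f i)) (x (f (i + 1))) =
      c ^ k + a ^ k := by
  classical
  have hint : ∀ S : Finset (ZMod k), Integrable fun x : V → unitInterval =>
      ∏ i ∈ S, (halfSign (x (f i)) * halfSign (x (f (i + 1)))) := by
    intro S
    have hm : Measurable fun x : V → unitInterval =>
        ∏ i ∈ S, (halfSign (x (f i)) * halfSign (x (f (i + 1)))) :=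
      Finset.measurable_prod _ fun i _ => (measurable_halfSign.comp (by fun_prop)).mul
        (measurable_halfSign.comp (by fun_prop))
    refine Integrable.of_bound hm.aestronglyMeasurable 1 (Eventually.of_forall fun x => ?_)
    rw [norm_prod]
    refine Finset.prod_le_one (fun _ _ => norm_nonneg _) fun i _ => ?_
    simp only [halfSign]
    split_ifs <;> norm_num
  have hexp : ∀ x : V → unitInterval,
      ∏ i, (blockKernel (c + a) (c - a)).toFun (x (f i)) (x (f (i + 1))) =
      ∑ S : Finset (ZMod k), a ^ S.card * c ^ (Finset.univ \ S).card *
        ∏ i ∈ S, (halfSign (x (f i)) * halfSign (x (f (i + 1)))) := by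
    intro x
    simp only [blockKernel_apply]
    simp only [add_comm c]
    rw [Finset.prod_add, Finset.powerset_univ]
    refine Finset.sum_congr rfl fun S _ => ?_
    rw [Finset.prod_mul_distrib, Finset.prod_const, Finset.prod_const]
    ring
  simp only [hexp]
  rw [integral_finsetSum _ fun S _ => (hint S).const_mul _]
  simp only [integral_const_mul]
  rw [Finset.sum_eq_add (∅ : Finset (ZMod k)) Finset.univ Finset.univ_nonempty.ne_empty.symm]
  · congr 1
    · simp
    · have h1 : ∀ x : V → unitInterval,
          ∏ i, (halfSign (x (f i)) * halfSign (x (f (i + 1)))) = 1 := by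
        intro x
        rw [Finset.prod_mul_distrib,
          Fintype.prod_equiv (Equiv.addRight (1 : ZMod k)) (fun i => halfSign (x (f (i + 1))))
            (fun i => halfSign (x (f i))) fun i => rfl, ← Finset.prod_mul_distrib]
        exact Finset.prod_eq_one fun i _ => halfSign_mul_self _
      simp [h1]
  · intro S _ hS
    rw [integral_prod_halfSign hf (Finset.nonempty_iff_ne_empty.2 hS.1) hS.2, mul_zero]
  · simp
  · simp

end Block

/-! ### Expected counts and arbitrary couplings -/

section Expectation

variable {n k : ℕ} [NeZero k]

theorem integral_earCount_le {κ : GraphKernel} {q : ℝ} (hn : 0 < n)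
    (hq : ∀ x y, κ.toFun x y ≤ q) (hq0 : 0 ≤ q) (hqn : q ≤ n) (m : ℕ) :
    ∫ G, (earCount k m G : ℝ) ∂sparseGraphLaw n κ ≤ k ^ 2 * q ^ (k + m + 1) / n := by
  classical
  have h1 : ∀ G : SimpleGraph (Fin n), earCount k m G = ((Finset.univ.filter
      fun p : (ZMod k → Fin n) × (Fin (m + 2) → Fin n) => IsEar p.1 p.2).filter
      fun p => Set.range (Sum.elim (cycleEdge p.1) (pathEdge p.2)) ⊆ G.edgeSet).card := by
    intro G
    rw [Finset.filter_filter, earCount]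
  simp only [h1]
  rw [integral_card_filter]
  have hn' : (0 : ℝ) < n := by exact_mod_cast hn
  calc _ ≤ _ := Finset.sum_le_card_nsmul _ _ ((q / n) ^ (k + m + 1)) fun p hp => by
          have := prob_edges_le hq hqn hq0 (Finset.mem_filter.1 hp).2.edges
          rwa [Fintype.card_sum, ZMod.card, Fintype.card_fin, ← add_assoc] at this
    _ ≤ ((n : ℝ) ^ (k + m) * k ^ 2) * (q / n) ^ (k + m + 1) := by
          rw [nsmul_eq_mul]
          gcongr
          exact_mod_cast (card_isEar_le (V := Fin n) k m).trans_eq (by rw [Fintype.card_fin])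
    _ = k ^ 2 * q ^ (k + m + 1) / n := by
          rw [div_pow, pow_succ (n : ℝ) (k + m)]
          field_simp

theorem integral_cycleCount (κ : GraphKernel) :
    ∫ G, (cycleCount k G : ℝ) ∂sparseGraphLaw n κ =
      ∑ f : {f : ZMod k → Fin n // Function.Injective f},
        (sparseGraphLaw n κ).real {G | Set.range (cycleEdge f.1) ⊆ G.edgeSet} := by
  classical
  have h1 : ∀ G : SimpleGraph (Fin n), cycleCount k G = ((Finset.univ.filter
      fun f : ZMod k → Fin n => Function.Injective f).filter
      fun f => Set.range (cycleEdge f) ⊆ G.edgeSet).card := by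
    intro G
    rw [Finset.filter_filter, cycleCount]
    congr
  simp only [h1]
  rw [integral_card_filter]
  exact (Finset.sum_subtype _ (by simp) _)

theorem card_injective (k n : ℕ) [NeZero k] :
    Nat.card {f : ZMod k → Fin n // Function.Injective f} = n.descFactorial k := by
  classical
  rw [Nat.card_congr (Equiv.subtypeInjectiveEquivEmbedding _ _), Nat.card_eq_fintype_card,
    Fintype.card_embedding_eq, ZMod.card, Fintype.card_fin]

theorem integral_cycleCount_blockKernel (hk : 3 ≤ k) {c a : ℝ} (ha : |a| ≤ c)
    (hn : 2 * c ≤ n) :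
    ∫ G, (cycleCount k G : ℝ) ∂sparseGraphLaw n (blockKernel (c + a) (c - a)) =
      n.descFactorial k * ((c ^ k + a ^ k) / n ^ k) := by
  obtain ⟨h1, h2⟩ := abs_le.1 ha
  have hval : ∀ x y, 0 ≤ (blockKernel (c + a) (c - a)).toFun x y ∧
      (blockKernel (c + a) (c - a)).toFun x y ≤ n := by
    intro x y
    simp only [blockKernel]
    split_ifs <;> constructor <;> linarith
  rw [integral_cycleCount, Finset.sum_congr rfl fun f _ => by
    rw [prob_cycle_eq hk (fun x y => (hval x y).1) (fun x y => (hval x y).2) f.2,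
      integral_prod_blockKernel f.2], Finset.sum_const, nsmul_eq_mul, Finset.card_univ,
    ← Nat.card_eq_fintype_card, card_injective]

theorem integral_cycleCount_constKernel_le (hk : 3 ≤ k) {c : ℝ} (hc : 0 ≤ c) (hn : c ≤ n) :
    ∫ G, (cycleCount k G : ℝ) ∂sparseGraphLaw n (constKernel c) ≤
      n.descFactorial k * (c ^ k / n ^ k) := by
  rw [integral_cycleCount]
  refine (Finset.sum_le_card_nsmul _ _ ((c / n) ^ k) fun f _ => ?_).trans_eq ?_
  · have := prob_edges_le (κ := constKernel c) (fun _ _ => le_rfl) hn hc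
      (cycleEdge_injective hk f.2)
    rwa [ZMod.card] at this
  · rw [nsmul_eq_mul, Finset.card_univ, ← Nat.card_eq_fintype_card, card_injective, div_pow]

/-- Comparison of the expected cycle counts under an arbitrary coupling. -/
theorem integral_cycleCount_le {P Q : Measure (SimpleGraph (Fin n))} [IsProbabilityMeasure P]
    (hk : 3 ≤ k) {μ : Measure (SimpleGraph (Fin n) × SimpleGraph (Fin n))}
    (hμ : IsCoupling μ P Q) :
    ∫ G, (cycleCount k G : ℝ) ∂P ≤ ∫ G, (cycleCount k G : ℝ) ∂Q +
      2 * k * ∫ p, (editDist p.1 p.2 : ℝ) ∂μ +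
      ∑ m ∈ Finset.range k, ∫ G, (earCount k m G : ℝ) ∂P := by
  obtain ⟨rfl, rfl⟩ := hμ
  have : IsProbabilityMeasure μ := Measure.isProbabilityMeasure_of_map Prod.fst
  have hfst : ∀ F : SimpleGraph (Fin n) → ℝ, ∫ G, F G ∂μ.map Prod.fst = ∫ p, F p.1 ∂μ := fun F =>
    integral_map measurable_fst.aemeasurable
      (Integrable.of_finite (μ := μ.map Prod.fst)).aestronglyMeasurable
  have hsnd : ∀ F : SimpleGraph (Fin n) → ℝ, ∫ G, F G ∂μ.map Prod.snd = ∫ p, F p.2 ∂μ := fun F =>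
    integral_map measurable_snd.aemeasurable
      (Integrable.of_finite (μ := μ.map Prod.snd)).aestronglyMeasurable
  simp only [hfst, hsnd]
  rw [← integral_finsetSum _ fun _ _ => Integrable.of_finite, ← integral_const_mul,
    ← integral_add Integrable.of_finite Integrable.of_finite,
    ← integral_add Integrable.of_finite Integrable.of_finite]
  refine integral_mono Integrable.of_finite Integrable.of_finite fun p => ?_
  simp only
  exact_mod_cast cycleCount_le_add_editDist hk p.1 p.2

/-- By Bernoulli, `(1 - k / n) ^ k ≥ 1 - k ^ 2 / n ≥ 1 / 2`. -/
theorem half_pow_le_descFactorial {n k : ℕ} (h : 2 * k ^ 2 ≤ n) :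
    (n : ℝ) ^ k / 2 ≤ n.descFactorial k := by
  rcases Nat.eq_zero_or_pos n with rfl | hn
  · have : k = 0 := by nlinarith
    subst this
    norm_num
  have hn' : (0 : ℝ) < n := by exact_mod_cast hn
  have hkn : k ≤ n := by nlinarith
  have h' : (2 : ℝ) * k ^ 2 ≤ n := by exact_mod_cast h
  have hk1 : (k : ℝ) / n ≤ 1 := (div_le_one hn').2 (by exact_mod_cast hkn)
  have hb := one_add_mul_le_pow (a := -((k : ℝ) / n)) (by linarith) k
  have hle : (1 : ℝ) / 2 ≤ (1 + -((k : ℝ) / n)) ^ k := by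
    refine le_trans ?_ hb
    have : (k : ℝ) * (k / n) ≤ 1 / 2 := by
      rw [mul_div_assoc', div_le_iff₀ hn']
      nlinarith
    linarith
  calc (n : ℝ) ^ k / 2 = n ^ k * (1 / 2) := by ring
    _ ≤ n ^ k * (1 + -((k : ℝ) / n)) ^ k := by gcongr
    _ = (n - k) ^ k := by
      rw [← mul_pow]
      congr 1
      field_simp
      ring
    _ = ((n - k : ℕ) : ℝ) ^ k := by rw [Nat.cast_sub hkn]
    _ ≤ ((n + 1 - k : ℕ) : ℝ) ^ k := by
      gcongr
      omega
    _ ≤ _ := by exact_mod_cast Nat.pow_sub_le_descFactorial n k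

/-- The expected edit distance is at least of the order of the difference between the expected
numbers of `k`-cycles, as long as few cycles intersect. -/
theorem le_integral_editDist (hk : 3 ≤ k) {c a B : ℝ} (ha : |a| ≤ c) (hak : 0 ≤ a ^ k)
    (hB : 2 * c ≤ B) (hB1 : 1 ≤ B) (hBn : B ≤ n) (hkn : 2 * k ^ 2 ≤ n)
    (hn : 4 * k ^ 3 * B ^ (2 * k) ≤ a ^ k * n)
    {μ : Measure (SimpleGraph (Fin n) × SimpleGraph (Fin n))}
    (hμ : IsCoupling μ (sparseGraphLaw n (blockKernel (c + a) (c - a)))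
      (sparseGraphLaw n (constKernel c))) :
    a ^ k / (8 * k) ≤ ∫ p, (editDist p.1 p.2 : ℝ) ∂μ := by
  obtain ⟨h1, h2⟩ := abs_le.1 ha
  have hn0 : (0 : ℝ) < n := by linarith
  have hk0 : (0 : ℝ) < k := by exact_mod_cast (by omega : 0 < k)
  -- Each of the `k` ear lengths contributes at most `k ^ 2 * B ^ (2 * k) / n`, as `k + m + 1 ≤ 2 *
  -- k` and `B ≥ 1`. The ears thus use up only half of the gap `a ^ k / 2` between the cycle counts.
  have hears : ∑ m ∈ Finset.range k, ∫ G, (earCount k m G : ℝ)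
      ∂sparseGraphLaw n (blockKernel (c + a) (c - a)) ≤ a ^ k / 4 := by
    refine (Finset.sum_le_card_nsmul _ _ (k ^ 2 * B ^ (2 * k) / n) fun m hm => ?_).trans ?_
    · refine (integral_earCount_le (q := B) (by exact_mod_cast hn0) (fun x y => ?_) (by linarith)
        hBn m).trans ?_
      · simp only [blockKernel]
        split_ifs <;> linarith
      · gcongr
        · have := Finset.mem_range.1 hm
          omega
    · rw [Finset.card_range, nsmul_eq_mul, mul_div_assoc', div_le_iff₀ hn0]
      nlinarith
  have hmain := integral_cycleCount_le hk hμ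
  rw [integral_cycleCount_blockKernel hk ha (hB.trans hBn)] at hmain
  have hconst := integral_cycleCount_constKernel_le (n := n) hk (c := c) (by linarith [abs_nonneg a])
    (by linarith [abs_nonneg a])
  have hdiff : a ^ k / 2 ≤ n.descFactorial k * ((c ^ k + a ^ k) / n ^ k) -
      n.descFactorial k * (c ^ k / n ^ k) := by
    have : (1 : ℝ) / 2 ≤ n.descFactorial k / n ^ k := by
      rw [le_div_iff₀ (by positivity)]
      linarith [half_pow_le_descFactorial hkn]
    calc a ^ k / 2 = 1 / 2 * a ^ k := by ring
      _ ≤ n.descFactorial k / n ^ k * a ^ k := by gcongr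
      _ = _ := by ring
  rw [div_le_iff₀ (by positivity)]
  linarith

end Expectation

/-! ### Choice of the cycle length -/

section Asymptotics

theorem tendsto_log_rpow_third :
    Tendsto (fun n : ℕ => Real.log n ^ (1 / 3 : ℝ)) atTop atTop :=
  (tendsto_rpow_atTop (by norm_num)).comp (Real.tendsto_log_atTop.comp tendsto_natCast_atTop_atTop)

/-- The rate is eventually at most `1`, so a constant lower bound is enough; 4-cycles give one, `4`
being even and at least `3`. -/
theorem everyCouplingOmega_of_le_one {c a : ℝ} (ha : |a| ≤ c) (ha0 : a ≠ 0) {b : ℝ} (hb : 0 ≤ b)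
    (hb1 : b ≤ 1) :
    EveryCouplingOmega (blockKernel (c + a) (c - a)) (constKernel c) (cycleRate b) := by
  have hpos : 0 < a ^ 4 := by positivity
  have hc : 0 ≤ c := (abs_nonneg a).trans ha
  refine ⟨a ^ 4 / (8 * 4), by positivity, ?_⟩
  have hlarge := (tendsto_natCast_atTop_atTop (R := ℝ)).eventually_ge_atTop
    (4 * 4 ^ 3 * (2 * c + 1) ^ (2 * 4) / a ^ 4)
  filter_upwards [hlarge, (tendsto_natCast_atTop_atTop (R := ℝ)).eventually_ge_atTop (2 * c + 1),
    eventually_ge_atTop (2 * 4 ^ 2), tendsto_log_rpow_third.eventually_ge_atTop 1]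
    with n h1 h2 h3 hL μ hμ
  have hrate : cycleRate b n ≤ 1 :=
    div_le_one_of_le₀ ((Real.rpow_le_one hb hb1 (by linarith)).trans hL) (by linarith)
  have key := le_integral_editDist (k := 4) (B := 2 * c + 1) (by norm_num) ha hpos.le (by linarith)
    (by linarith) h2 h3 (by
      rw [div_le_iff₀ hpos] at h1
      norm_num at h1 ⊢
      linarith) hμ
  push_cast at key
  refine le_trans ?_ key
  exact mul_le_of_le_one_right (by positivity) hrate

theorem everyCouplingOmega_of_one_lt {c a : ℝ} (ha : |a| ≤ c) (ha1 : 1 < |a|) :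
    EveryCouplingOmega (blockKernel (c + a) (c - a)) (constKernel c) (cycleRate c) := by
  have hc1 : 1 < c := ha1.trans_le ha
  set A := Real.logb |a| c with hA
  have hAc : |a| ^ A = c := Real.rpow_logb (by linarith) (by linarith) (by linarith)
  have hA1 : 1 ≤ A := by
    rw [hA, Real.le_logb_iff_rpow_le ha1 (by linarith), Real.rpow_one]
    exact ha
  set B := 2 * c + 1 with hB
  have hlogB : 0 ≤ Real.log B := Real.log_nonneg (by linarith)
  -- The length below satisfies `2 * A * L ≤ k ≤ 4 * A * L`, so `8 * k ≤ 32 * A * L`.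
  refine ⟨1 / (32 * A), by positivity, ?_⟩
  filter_upwards [tendsto_log_rpow_third.eventually_ge_atTop (4 + (3 + 2 * Real.log B) * (4 * A)),
    eventually_ge_atTop 1] with n hL hn μ hμ
  have hn0 : (0 : ℝ) < n := by exact_mod_cast hn
  set L := Real.log n ^ (1 / 3 : ℝ) with hLdef
  have hL4 : 4 ≤ L := le_trans (by nlinarith [mul_nonneg hlogB (by linarith : 0 ≤ A)]) hL
  have hL3 : L ^ 3 = Real.log n := by
    rw [hLdef, ← Real.rpow_natCast, ← Real.rpow_mul (Real.log_natCast_nonneg n)]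
    norm_num
  set N := ⌈A * L⌉₊ with hN
  have hNge : A * L ≤ N := Nat.le_ceil _
  have hNle : (N : ℝ) ≤ 2 * (A * L) := by
    have := Nat.ceil_lt_add_one (a := A * L) (by positivity)
    nlinarith
  have hAL : 4 ≤ A * L := by nlinarith
  have hN4 : (4 : ℝ) ≤ N := hAL.trans hNge
  have hN4' : 4 ≤ N := by exact_mod_cast hN4
  set k := 2 * N with hk
  have hkcast : (k : ℝ) = 2 * N := by rw [hk]; push_cast; rfl
  have : NeZero k := ⟨by omega⟩
  have hak : a ^ k = |a| ^ k := by rw [hk, pow_mul, pow_mul, sq_abs]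
  have hak1 : 1 ≤ a ^ k := hak ▸ one_le_pow₀ ha1.le
  have hk1 : (1 : ℝ) ≤ k := by linarith
  have hB1 : 1 ≤ B := by linarith
  -- The logarithm of the left side is at most a constant times `L`, hence at most `L ^ 2 ≤ L ^ 3 =
  -- log n`.
  have hbig : 4 * (k : ℝ) ^ 3 * B ^ (2 * k) ≤ n := by
    have e1 : (k : ℝ) ^ 3 ≤ Real.exp (3 * k) := by
      rw [show (3 : ℝ) * k = (3 : ℕ) * (k : ℝ) by norm_num, Real.exp_nat_mul]
      gcongr
      linarith [Real.add_one_le_exp (k : ℝ)]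
    have e2 : B ^ (2 * k) = Real.exp (2 * k * Real.log B) := by
      rw [show 2 * (k : ℝ) * Real.log B = ((2 * k : ℕ) : ℝ) * Real.log B by push_cast; ring,
        Real.exp_nat_mul, Real.exp_log (by linarith)]
    have e3 : (4 : ℝ) ≤ Real.exp 3 := by linarith [Real.add_one_le_exp (3 : ℝ)]
    calc 4 * (k : ℝ) ^ 3 * B ^ (2 * k) ≤
          Real.exp 3 * Real.exp (3 * k) * Real.exp (2 * k * Real.log B) := by
          rw [e2]
          gcongr
      _ = Real.exp (3 + (3 + 2 * Real.log B) * k) := by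
          rw [← Real.exp_add, ← Real.exp_add]
          congr 1
          ring
      _ ≤ Real.exp (L ^ 3) := by
          refine Real.exp_le_exp.2 ?_
          have hkL : (k : ℝ) ≤ 4 * A * L := by linarith
          calc 3 + (3 + 2 * Real.log B) * k ≤ 4 * L + (3 + 2 * Real.log B) * (4 * A * L) := by
                gcongr
                linarith
            _ = (4 + (3 + 2 * Real.log B) * (4 * A)) * L := by ring
            _ ≤ L * L := by gcongr
            _ ≤ L ^ 3 := by nlinarith [mul_nonneg (by linarith : 0 ≤ L) (by linarith : 0 ≤ L)]
      _ = n := by rw [hL3, Real.exp_log hn0]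
  have hk2 : 2 * k ^ 2 ≤ n := by
    have : (2 : ℝ) * k ^ 2 ≤ n := by
      refine le_trans ?_ hbig
      have h1 : (1 : ℝ) ≤ B ^ (2 * k) := one_le_pow₀ hB1
      have h2 : (k : ℝ) ^ 2 ≤ k ^ 3 := pow_le_pow_right₀ hk1 (by norm_num)
      nlinarith [pow_nonneg (by linarith : (0 : ℝ) ≤ k) 3]
    exact_mod_cast this
  have hBn : B ≤ n := by
    refine le_trans ?_ hbig
    have h1 : B ≤ B ^ (2 * k) := le_self_pow₀ hB1 (by omega)
    have h2 : (1 : ℝ) ≤ k ^ 3 := one_le_pow₀ hk1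
    nlinarith
  have key := le_integral_editDist (k := k) (B := B) (by omega) ha (by linarith) (by linarith)
    hB1 hBn hk2 (hbig.trans (le_mul_of_one_le_left hn0.le hak1)) hμ
  refine le_trans ?_ key
  -- `c ^ L = |a| ^ (A * L)` and `A * L ≤ k`.
  have hpow : c ^ L ≤ a ^ k := by
    rw [hak, ← Real.rpow_natCast]
    nth_rewrite 1 [← hAc]
    rw [← Real.rpow_mul (abs_nonneg a)]
    refine Real.rpow_le_rpow_of_exponent_le ha1.le ?_
    linarith
  have hcL : 0 ≤ c ^ L := Real.rpow_nonneg (by linarith) _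
  calc 1 / (32 * A) * cycleRate c n = c ^ L / (8 * (4 * A * L)) := by
        rw [cycleRate, ← hLdef]
        field_simp
        norm_num
    _ ≤ a ^ k / (8 * k) := by
        gcongr
        linarith

theorem EveryCouplingOmega.mono {κ₁ κ₂ : GraphKernel} {r r' : ℕ → ℝ}
    (h : EveryCouplingOmega κ₁ κ₂ r) (hr : ∀ᶠ n in atTop, r' n ≤ r n) :
    EveryCouplingOmega κ₁ κ₂ r' := by
  obtain ⟨C, hC, h⟩ := h
  refine ⟨C, hC, ?_⟩
  filter_upwards [h, hr] with n h hr μ hμ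
  exact (mul_le_mul_of_nonneg_left hr hC.le).trans (h μ hμ)

/-- Once `log n` is positive the exponent is nonzero and the rate vanishes. -/
theorem everyCouplingOmega_zero (κ₁ κ₂ : GraphKernel) :
    EveryCouplingOmega κ₁ κ₂ (cycleRate 0) := by
  refine ⟨1, one_pos, ?_⟩
  filter_upwards [tendsto_log_rpow_third.eventually_ge_atTop 1] with n hL μ _
  rw [cycleRate, Real.zero_rpow (by linarith), zero_div, mul_zero]
  exact integral_nonneg fun _ => Nat.cast_nonneg _

theorem everyCouplingOmega_blockKernel {c a : ℝ} (ha : |a| ≤ c) :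
    EveryCouplingOmega (blockKernel (c + a) (c - a)) (constKernel c) (cycleRate |a|) ∧
    (1 < |a| ∨ (0 < |a| ∧ c ≤ 1) →
      EveryCouplingOmega (blockKernel (c + a) (c - a)) (constKernel c) (cycleRate c)) := by
  constructor
  · rcases eq_or_ne a 0 with rfl | ha0
    · simpa using everyCouplingOmega_zero _ _
    rcases le_or_gt |a| 1 with h | h
    · exact everyCouplingOmega_of_le_one ha ha0 (abs_nonneg a) h
    · refine (everyCouplingOmega_of_one_lt ha h).mono ?_
      filter_upwards [tendsto_log_rpow_third.eventually_ge_atTop 1] with n hL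
      exact div_le_div_of_nonneg_right (Real.rpow_le_rpow (abs_nonneg a) ha (by linarith))
        (by linarith)
  · rintro (h | ⟨h, hc⟩)
    · exact everyCouplingOmega_of_one_lt ha h
    · exact everyCouplingOmega_of_le_one ha (abs_pos.1 h) ((abs_nonneg a).trans ha) hc

end Asymptotics

theorem theorem2 (c δ : ℝ) (hδ : 0 ≤ δ) (hδc : δ ≤ c) (κ : GraphKernel)
    (hκ : κ = blockKernel (c - δ) (c + δ) ∨ κ = blockKernel (c + δ) (c - δ)) :
    EveryCouplingOmega κ (constKernel c) (cycleRate δ) ∧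
    (1 < δ ∨ (0 < δ ∧ c ≤ 1) → EveryCouplingOmega κ (constKernel c) (cycleRate c)) := by
  rcases hκ with rfl | rfl
  · have := everyCouplingOmega_blockKernel (c := c) (a := -δ) (by rwa [abs_neg, abs_of_nonneg hδ])
    rwa [abs_neg, abs_of_nonneg hδ, ← sub_eq_add_neg, sub_neg_eq_add] at this
  · have := everyCouplingOmega_blockKernel (c := c) (a := δ) (by rwa [abs_of_nonneg hδ])
    rwa [abs_of_nonneg hδ] at this
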